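/- Let $(Y_{ij})_{i,j\ge 1}$ be independent and identically distributed real random variables with $\mathrm{E}(Y_{ij})=0$, $\mathrm{Var}(Y_{ij})=\sigma^2$ for some $\sigma\in(0,\infty)$, and $\mathrm{E}(|Y_{ij}|^{4+\varepsilon})<\infty$ for some $\varepsilon>0$. (These are the errors in the model $X_{ij}=\mu(i/n,j/m)+Y_{ij}$, $1\le i\le n$, $1\le j\le m$. Under the null hypothesis that $\mu$ is constant, $\hat\nu_{hk}$ below is the mean of the observations $X_{ij}$ in block $(h,k)$ minus $\mu$. The statement involves the errors only.) Let $s_1,s_2\in(1/2,1)$ and let the block lengths be $n^{s_1}$ and $m^{s_2}$ up to rounding, i.e. let $l_n$ and $l_m$ be integers, depending only on $n$ and only on $m$ respectively, with $|l_n-n^{s_1}|<1$ and $|l_m-m^{s_2}|<1$ for all $n,m\ge 1$. Let $b_n=\lfloor n/l_n\rfloor$ and $b_m=\lfloor m/l_m\rfloor$ be the numbers of blocks. For $1\le h\le b_n$, $1\le k\le b_m$ let $$\hat\nu_{hk}^{(n,m)}=\frac{1}{l_n l_m}\sum_{i=(h-1)l_n+1}^{h l_n}\ \sum_{j=(k-1)l_m+1}^{k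 l_m} Y_{ij},\qquad \tilde\nu_{hk}^{(n,m)}=\sqrt{l_n l_m}\;\hat\nu_{hk}^{(n,m)},$$ and let $\kappa^{(4)}_{a,b}$ denote the fourth standardized moment $\mathrm{E}[(Z-\mathrm{E}Z)^4]/\mathrm{Var}(Z)^2$ of $Z=\frac{1}{\sqrt{ab}}\sum_{i=1}^{a}\sum_{j=1}^{b}Y_{ij}$. Then $$\frac{1}{\sqrt{\kappa^{(4)}_{l_n,l_m}-1}}\left[\frac{1}{\sigma^2\sqrt{b_n b_m}}\sum_{h=1}^{b_n}\sum_{k=1}^{b_m}\left(\tilde\nu_{hk}^{(n,m)}\right)^2-\sqrt{b_n b_m}\right]\ \overset{\mathcal D}{\longrightarrow}\ \mathcal N(0,1)\qquad\text{as } N=nm\to\infty .$$ -/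

import Mathlib

open MeasureTheory ProbabilityTheory Filter

noncomputable section

variable {Ω : Type*} [MeasurableSpace Ω]

/-- Number of blocks of length `l` that fit into `n` observations: `b = ⌊n / l⌋`
(equivalently `l * b = n` when `l` divides `n`). -/
def numBlocks (l n : ℕ) : ℕ := n / l

/-- The set of indices `{(h-1)l₁+1, …, h l₁} × {(k-1)l₂+1, …, k l₂}` of block `(h, k)`, for
blocks of side lengths `l₁ × l₂` and `h, k ≥ 1`. -/
def blockIndices (l₁ l₂ h k : ℕ) : Finset (ℕ × ℕ) :=
  Finset.Icc ((h - 1) * l₁ + 1) (h * l₁) ×ˢ Finset.Icc ((k - 1) * l₂ + 1) (k * l₂)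

/-- The mean `ν̂_{hk}` of the noise `Y` over block `(h, k)`. -/
def blockMean (Y : ℕ → ℕ → Ω → ℝ) (l₁ l₂ h k : ℕ) (ω : Ω) : ℝ :=
  1 / ((l₁ : ℝ) * l₂) * ∑ p ∈ blockIndices l₁ l₂ h k, Y p.1 p.2 ω

/-- The normalized block mean `ν̃_{hk} = √(l₁ l₂) ν̂_{hk}`. -/
def normBlockMean (Y : ℕ → ℕ → Ω → ℝ) (l₁ l₂ h k : ℕ) (ω : Ω) : ℝ :=
  √((l₁ : ℝ) * l₂) * blockMean Y l₁ l₂ h k ω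

/-- The fourth standardized moment `E[(Z - E Z)⁴] / Var(Z)²` of a random variable `Z`. -/
def fourthStdMoment (Z : Ω → ℝ) (P : Measure Ω) : ℝ :=
  centralMoment Z 4 P / Var[Z; P] ^ 2

/-- `κ⁽⁴⁾_{a,b}`: the fourth standardized moment of
`(1 / √(a b)) ∑_{i=1}^a ∑_{j=1}^b Y_{ij}`. -/
def kappa4 (Y : ℕ → ℕ → Ω → ℝ) (P : Measure Ω) (a b : ℕ) : ℝ :=
  fourthStdMoment
    (fun ω => 1 / √((a : ℝ) * b) * ∑ i ∈ Finset.Icc 1 a, ∑ j ∈ Finset.Icc 1 b, Y i j ω) P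

/-- The statistic
`(κ⁽⁴⁾_{l₁,l₂} - 1)^{-1/2} [ (σ² √(b₁ b₂))⁻¹ ∑_{h=1}^{b₁} ∑_{k=1}^{b₂} ν̃_{hk}² - √(b₁ b₂) ]`
for `b₁ × b₂` blocks of side lengths `l₁ × l₂`. -/
def blockStatistic (Y : ℕ → ℕ → Ω → ℝ) (P : Measure Ω) (σ : ℝ) (l₁ l₂ b₁ b₂ : ℕ) (ω : Ω) : ℝ :=
  1 / √(kappa4 Y P l₁ l₂ - 1) *
    (1 / (σ ^ 2 * √((b₁ : ℝ) * b₂)) *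
        ∑ h ∈ Finset.Icc 1 b₁, ∑ k ∈ Finset.Icc 1 b₂, normBlockMean Y l₁ l₂ h k ω ^ 2
      - √((b₁ : ℝ) * b₂))

end

/-! Scale the errors to unit variance, with fourth moment `m`. The statistic is then a normalized
sum, over B = b_n b_m disjoint blocks, of iid copies of S_M²/M - 1, where S_M is a sum of M = l_n
l_m errors. Its characteristic function is therefore a B-th power of that of one summand
(`charFun_map_blockStatistic`).

The law of a summand changes with M, so a triangular-array limit theorem is needed. The classical
CLT gives weak convergence of the summands to Z² - 1 with Z standard normal, and E(S_M⁴)/M² = 3 + (m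
- 3)/M gives convergence of their variances to 2. Together these yield uniformly integrable squares
(`tendsto_integral_sq_mul_min`), hence a Lindeberg-type estimate however M and B are coupled, and
`tendsto_charFun_pow_of_tendsto` follows. By `kappa4_eq` the normalization κ - 1 is exactly the
variance of a summand.

Finally, nm → ∞ alone forces M, B → ∞, even if n or m stays bounded (`tendsto_mul_comap_mul_atTop`).
-/

/-! ### Characteristic functions and a triangular-array CLT -/

open Topology in
/-- If `B (z - 1) → s` and `B → ∞`, then `z ^ B → exp s`, along any filter. -/
theorem tendsto_pow_exp_of_tendsto_mul_sub_one {ι : Type*} {l : Filter ι} {z : ι → ℂ} {B : ι → ℕ}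
    {s : ℂ} (hB : Tendsto B l atTop)
    (hz : Tendsto (fun i => (B i : ℂ) * (z i - 1)) l (𝓝 s)) :
    Tendsto (fun i => z i ^ B i) l (𝓝 (Complex.exp s)) := by
  have hBinv : Tendsto (fun i => ((B i : ℂ))⁻¹) l (𝓝 0) :=
    (tendsto_inv_atTop_nhds_zero_nat (𝕜 := ℂ)).comp hB
  have hB0 : ∀ᶠ i in l, B i ≠ 0 := hB.eventually_ne_atTop 0
  have hu : Tendsto (fun i => z i - 1) l (𝓝 0) := by
    have h := hBinv.mul hz
    rw [zero_mul] at h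
    refine h.congr' ?_
    filter_upwards [hB0] with i hi
    rw [inv_mul_cancel_left₀ (Nat.cast_ne_zero.2 hi)]
  -- With u = z - 1, log(1 + u) = u + O(u²), and B u² = (B u)² / B = O(1/B).
  have hlog : Tendsto (fun i => (B i : ℂ) * Complex.log (1 + (z i - 1))) l (𝓝 s) := by
    apply hz.congr_dist
    have hO : (fun i => dist ((B i : ℂ) * (z i - 1)) ((B i : ℂ) * Complex.log (1 + (z i - 1))))
        =O[l] fun i => ((B i : ℂ))⁻¹ := by
      simp_rw [dist_comm (_ * (z _ - 1)), dist_eq_norm, ← mul_sub, Asymptotics.isBigO_norm_left]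
      calc
        _ =O[l] fun i => (B i : ℂ) * (z i - 1) ^ 2 :=
          (Asymptotics.isBigO_refl _ _).mul (Complex.log_sub_self_isBigO.comp_tendsto hu)
        _ =ᶠ[l] fun i => ((B i : ℂ) * (z i - 1)) ^ 2 * ((B i : ℂ))⁻¹ := by
          filter_upwards [hB0] with i hi
          rw [eq_mul_inv_iff_mul_eq₀ (Nat.cast_ne_zero.2 hi)]
          ring
        _ =O[l] _ := by
          simpa using (hz.isBigO_one ℂ).pow 2 |>.mul (Asymptotics.isBigO_refl _ _)
    exact hO.trans_tendsto hBinv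
  refine ((Complex.continuous_exp.tendsto _).comp hlog).congr' ?_
  filter_upwards [hu.eventually_ne (show (0 : ℂ) ≠ -1 by simp)] with i hi
  have hz0 : 1 + (z i - 1) ≠ 0 := fun h => hi (by linear_combination h)
  simp only [Function.comp_apply]
  rw [Complex.exp_nat_mul, Complex.exp_log hz0, add_sub_cancel]

/-- Cubic Taylor remainder for |x| ≤ 1, triangle inequality beyond. The minimum keeps the bound
integrable with second moments only; a third moment of the squared block sums is not available. -/
theorem norm_exp_mul_I_sub_taylor_two_le (x : ℝ) :
    ‖Complex.exp (x * Complex.I) - (1 + x * Complex.I - x ^ 2 / 2)‖ ≤ 4 * (x ^ 2 * min 1 |x|) := by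
  have hn : ‖(x * Complex.I : ℂ)‖ = |x| := by simp
  rcases le_total |x| 1 with h | h
  · have := Complex.exp_bound (x := x * Complex.I) (by rw [hn]; exact h) (n := 3) (by norm_num)
    rw [hn] at this
    have hs : ∑ m ∈ Finset.range 3, (x * Complex.I : ℂ) ^ m / (m.factorial : ℂ)
        = 1 + x * Complex.I - x ^ 2 / 2 := by
      simp [Finset.sum_range_succ, mul_pow]
      ring
    rw [hs] at this
    refine this.trans ?_
    rw [min_eq_right h, ← sq_abs x, ← pow_succ]
    norm_num [Nat.factorial]
    linarith [pow_nonneg (abs_nonneg x) 3]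
  · rw [min_eq_left h]
    have h1 : ‖Complex.exp (x * Complex.I)‖ = 1 := Complex.norm_exp_ofReal_mul_I x
    have h2 : ‖((x : ℂ) ^ 2 / 2)‖ = |x| ^ 2 / 2 := by simp
    calc _ ≤ ‖Complex.exp (x * Complex.I)‖ + ‖(1 + x * Complex.I - x ^ 2 / 2 : ℂ)‖ := norm_sub_le _ _
      _ ≤ 1 + (1 + |x| + |x| ^ 2 / 2) := by
        rw [h1]
        gcongr
        refine (norm_sub_le _ _).trans ?_
        rw [h2]
        gcongr
        refine (norm_add_le _ _).trans ?_
        rw [hn]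
        simp
      _ ≤ 4 * (x ^ 2 * 1) := by
        rw [← sq_abs x]
        nlinarith

theorem integrable_sq_mul_min {μ : Measure ℝ} (h2 : Integrable (fun x => x ^ 2) μ) (c : ℝ) (hc : 0 ≤ c) :
    Integrable (fun x => x ^ 2 * min 1 (c * |x|)) μ := by
  refine h2.mono' (by fun_prop) (ae_of_all _ fun x => ?_)
  have : 0 ≤ min 1 (c * |x|) := by positivity
  rw [Real.norm_of_nonneg (by positivity)]
  exact mul_le_of_le_one_right (sq_nonneg x) (min_le_left _ _)

/-- Integrate the pointwise Taylor bound at `t * x`; the linear term vanishes by centring. -/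
theorem norm_charFun_sub_taylor_two_le {μ : Measure ℝ} [IsProbabilityMeasure μ]
    (h2 : Integrable (fun x => x ^ 2) μ) (h0 : ∫ x, x ∂μ = 0) (t : ℝ) :
    ‖charFun μ t - (1 - t ^ 2 * (∫ x, x ^ 2 ∂μ : ℝ) / 2)‖
      ≤ 4 * (t ^ 2 * ∫ x, x ^ 2 * min 1 (|t| * |x|) ∂μ) := by
  have hL2 : MemLp (fun x : ℝ => x) 2 μ := (memLp_two_iff_integrable_sq (by fun_prop)).2 h2
  have h1 : Integrable (fun x : ℝ => x) μ := hL2.integrable (by norm_num)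
  have h1c : Integrable (fun x : ℝ => (t * x : ℂ) * Complex.I) μ := (h1.ofReal.const_mul _).mul_const _
  have h2c : Integrable (fun x : ℝ => (t ^ 2 * (x ^ 2 : ℝ) / 2 : ℂ)) μ :=
    (h2.ofReal.const_mul _).div_const _
  have hexp : Integrable (fun x : ℝ => Complex.exp (t * x * Complex.I)) μ := by
    refine Integrable.of_bound (C := 1) (by fun_prop) (ae_of_all _ fun x => ?_)
    rw [← Complex.ofReal_mul, Complex.norm_exp_ofReal_mul_I]
  have key : charFun μ t - (1 - t ^ 2 * (∫ x, x ^ 2 ∂μ : ℝ) / 2)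
      = ∫ x : ℝ, (Complex.exp (t * x * Complex.I)
          - (1 + (t * x : ℂ) * Complex.I - t ^ 2 * (x ^ 2 : ℝ) / 2)) ∂μ := by
    have hc : Integrable (fun _ : ℝ => (1 : ℂ)) μ := integrable_const _
    have ha : Integrable (fun x : ℝ => (1 : ℂ) + (t * x : ℂ) * Complex.I) μ := hc.add h1c
    have hb : Integrable (fun x : ℝ => (1 : ℂ) + (t * x : ℂ) * Complex.I
        - (t ^ 2 * (x ^ 2 : ℝ) / 2 : ℂ)) μ := ha.sub h2c
    rw [charFun_apply_real, integral_sub hexp hb, integral_sub ha h2c, integral_add hc h1c,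
      integral_mul_const, integral_const_mul, integral_div, integral_const_mul]
    rw [integral_complex_ofReal, integral_complex_ofReal, h0]
    simp
  rw [key, ← integral_const_mul, ← integral_const_mul]
  refine (norm_integral_le_integral_norm _).trans (integral_mono (hexp.sub
    (((integrable_const _).add h1c).sub h2c)).norm
    (((integrable_sq_mul_min h2 |t| (abs_nonneg t)).const_mul _).const_mul _) fun x => ?_)
  have := norm_exp_mul_I_sub_taylor_two_le (t * x)
  push_cast at this ⊢
  rw [abs_mul, mul_pow, mul_pow, mul_assoc (t ^ 2)] at this
  exact this

open Topology in
/-- Under weak convergence together with convergence of second moments, the second moments are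
uniformly integrable. -/
theorem tendsto_integral_sq_mul_min {ι : Type*} {l : Filter ι} {μ : ι → ProbabilityMeasure ℝ}
    {ν : ProbabilityMeasure ℝ} (hμ : Tendsto μ l (𝓝 ν))
    (h2 : ∀ᶠ i in l, Integrable (fun x => x ^ 2) (μ i : Measure ℝ))
    (hν : Integrable (fun x => x ^ 2) (ν : Measure ℝ))
    (hv : Tendsto (fun i => ∫ x, x ^ 2 ∂(μ i : Measure ℝ)) l (𝓝 (∫ x, x ^ 2 ∂(ν : Measure ℝ))))
    {c : ι → ℝ} (hc0 : ∀ i, 0 ≤ c i) (hc : Tendsto c l (𝓝 0)) :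
    Tendsto (fun i => ∫ x, x ^ 2 * min 1 (c i * |x|) ∂(μ i : Measure ℝ)) l (𝓝 0) := by
  -- For fixed d the complementary part x²(1 - min 1 (d|x|)) vanishes for |x| ≥ 1/d, so it is a
  -- bounded continuous test function; subtract its integrals from the second moments.
  have hfix : ∀ d : ℝ, 0 < d → Tendsto (fun i => ∫ x, x ^ 2 * min 1 (d * |x|) ∂(μ i : Measure ℝ)) l
      (𝓝 (∫ x, x ^ 2 * min 1 (d * |x|) ∂(ν : Measure ℝ))) := by
    intro d hd
    have hbd : ∀ x : ℝ, ‖x ^ 2 * (1 - min 1 (d * |x|))‖ ≤ (d⁻¹) ^ 2 := by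
      intro x
      rcases le_total 1 (d * |x|) with h | h
      · rw [min_eq_left h]; simp; positivity
      · rw [min_eq_right h, Real.norm_of_nonneg (mul_nonneg (sq_nonneg x) (by linarith))]
        have hx : |x| ≤ d⁻¹ := by rw [← one_div, le_div_iff₀ hd]; linarith
        calc x ^ 2 * (1 - d * |x|) ≤ x ^ 2 * 1 := by
              gcongr
              have : 0 ≤ d * |x| := by positivity
              linarith
          _ = |x| ^ 2 := by rw [sq_abs, mul_one]
          _ ≤ _ := by gcongr
    let f : BoundedContinuousFunction ℝ ℝ :=
      BoundedContinuousFunction.ofNormedAddCommGroup (fun x => x ^ 2 * (1 - min 1 (d * |x|)))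
        (by fun_prop) _ hbd
    have hf := (ProbabilityMeasure.tendsto_iff_forall_integral_tendsto.1 hμ) f
    have hdiff := hv.sub hf
    have heq : ∀ m : Measure ℝ, [IsProbabilityMeasure m] → Integrable (fun x => x ^ 2) m →
        ∫ x, x ^ 2 ∂m - ∫ x, f x ∂m = ∫ x, x ^ 2 * min 1 (d * |x|) ∂m := by
      intro m _ hm
      rw [← integral_sub hm (f.integrable m)]
      congr 1
      ext x
      simp only [f, BoundedContinuousFunction.coe_ofNormedAddCommGroup]
      ring
    rw [heq _ hν] at hdiff
    refine hdiff.congr' ?_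
    filter_upwards [h2] with i hi using heq _ hi
  have hlim : Tendsto (fun n : ℕ => ∫ x, x ^ 2 * min 1 (1 / ((n : ℝ) + 1) * |x|) ∂(ν : Measure ℝ))
      atTop (𝓝 0) := by
    rw [show (0 : ℝ) = ∫ _, (0 : ℝ) ∂(ν : Measure ℝ) by simp]
    refine tendsto_integral_of_dominated_convergence (fun x => x ^ 2) (fun n => by fun_prop) hν
      (fun n => ae_of_all _ fun x => ?_) (ae_of_all _ fun x => ?_)
    · have : 0 ≤ min 1 (1 / ((n : ℝ) + 1) * |x|) := by positivity
      rw [Real.norm_of_nonneg (by positivity)]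
      exact mul_le_of_le_one_right (sq_nonneg x) (min_le_left _ _)
    · have h := (tendsto_one_div_add_atTop_nhds_zero_nat (𝕜 := ℝ)).mul_const |x|
      have := ((tendsto_const_nhds (x := (1 : ℝ))).min h).const_mul (x ^ 2)
      simpa using this
  rw [tendsto_order]
  refine ⟨fun a ha => Eventually.of_forall fun i => ha.trans_le
    (integral_nonneg fun x => ?_), fun a ha => ?_⟩
  · have := hc0 i
    positivity
  -- Fix d = 1/(n + 1) making the limit integral smaller than a. Eventually c i < d, and the
  -- integrand is monotone in that parameter.
  obtain ⟨n, hn⟩ := (hlim.eventually_lt_const ha).exists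
  have hd : (0 : ℝ) < 1 / ((n : ℝ) + 1) := by positivity
  filter_upwards [(hfix _ hd).eventually_lt_const hn, hc.eventually_lt_const hd, h2] with i h1 h3 h4
  refine (integral_mono (integrable_sq_mul_min h4 _ (hc0 i)) (integrable_sq_mul_min h4 _ hd.le)
    fun x => ?_).trans_lt h1
  dsimp only
  gcongr

open Topology in
/-- A central limit theorem for triangular arrays with iid rows, in terms of characteristic
functions: the law of a summand in row `i` is `μ i`, and there are `B i` summands. -/
theorem tendsto_charFun_pow_of_tendsto {ι : Type*} {l : Filter ι} {μ : ι → ProbabilityMeasure ℝ}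
    {ν : ProbabilityMeasure ℝ} (hμ : Tendsto μ l (𝓝 ν))
    (h2 : ∀ᶠ i in l, Integrable (fun x => x ^ 2) (μ i : Measure ℝ))
    (h0 : ∀ᶠ i in l, ∫ x, x ∂(μ i : Measure ℝ) = 0)
    (hν : Integrable (fun x => x ^ 2) (ν : Measure ℝ))
    (hv : Tendsto (fun i => ∫ x, x ^ 2 ∂(μ i : Measure ℝ)) l (𝓝 (∫ x, x ^ 2 ∂(ν : Measure ℝ))))
    {B : ι → ℕ} (hB : Tendsto B l atTop) {t : ι → ℝ} {t₀ : ℝ} (ht : Tendsto t l (𝓝 t₀)) :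
    Tendsto (fun i => charFun (μ i : Measure ℝ) (t i * (√(B i : ℝ))⁻¹) ^ B i) l
      (𝓝 (Complex.exp (-(t₀ ^ 2 * (∫ x, x ^ 2 ∂(ν : Measure ℝ) : ℝ) / 2 : ℝ)))) := by
  apply tendsto_pow_exp_of_tendsto_mul_sub_one hB
  have hsq : Tendsto (fun i => (√(B i : ℝ))⁻¹) l (𝓝 0) :=
    tendsto_inv_atTop_zero.comp (Real.tendsto_sqrt_atTop.comp (tendsto_natCast_atTop_atTop.comp hB))
  have hc : Tendsto (fun i => |t i * (√(B i : ℝ))⁻¹|) l (𝓝 0) := by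
    simpa using (ht.mul hsq).abs
  have hmin := tendsto_integral_sq_mul_min hμ h2 hν hv (fun i => abs_nonneg _) hc
  have hbound : Tendsto (fun i => 4 * (t i ^ 2 *
      ∫ x, x ^ 2 * min 1 (|t i * (√(B i : ℝ))⁻¹| * |x|) ∂(μ i : Measure ℝ))) l (𝓝 0) := by
    simpa using ((ht.pow 2).mul hmin).const_mul 4
  have hmain : Tendsto (fun i => ((-(t i ^ 2 * (∫ x, x ^ 2 ∂(μ i : Measure ℝ)) / 2) : ℝ) : ℂ)) l
      (𝓝 ((-(t₀ ^ 2 * (∫ x, x ^ 2 ∂(ν : Measure ℝ)) / 2) : ℝ) : ℂ)) :=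
    (Complex.continuous_ofReal.tendsto _).comp ((((ht.pow 2).mul hv).div_const 2).neg)
  rw [← Complex.ofReal_neg]
  refine tendsto_of_tendsto_of_dist hmain (squeeze_zero' (Eventually.of_forall fun i => dist_nonneg)
    ?_ hbound)
  filter_upwards [h2, h0, hB.eventually_ne_atTop 0] with i hi hi0 hBi
  have hBpos : (0 : ℝ) < B i := by positivity
  have hs : ((√(B i : ℝ))⁻¹) ^ 2 = (B i : ℝ)⁻¹ := by rw [inv_pow, Real.sq_sqrt hBpos.le]
  -- The squared argument contributes 1/B, which cancels the factor B in B(φ - 1).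
  have key := norm_charFun_sub_taylor_two_le hi hi0 (t i * (√(B i : ℝ))⁻¹)
  rw [mul_pow, hs] at key
  have key2 := mul_le_mul_of_nonneg_left key hBpos.le
  rw [dist_comm, dist_eq_norm]
  have hBc : (B i : ℂ) ≠ 0 := Nat.cast_ne_zero.2 hBi
  have hsc : ((√(B i : ℝ) : ℂ)⁻¹) ^ 2 = (B i : ℂ)⁻¹ := by
    rw [← Complex.ofReal_inv, ← Complex.ofReal_pow, hs, Complex.ofReal_inv, Complex.ofReal_natCast]
  calc _ = ‖(B i : ℂ) * (charFun (μ i : Measure ℝ) (t i * (√(B i : ℝ))⁻¹)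
        - (1 - ((t i * (√(B i : ℝ))⁻¹ : ℝ) : ℂ) ^ 2 * (∫ x, x ^ 2 ∂(μ i : Measure ℝ) : ℝ) / 2))‖ := by
        congr 1
        push_cast
        rw [mul_pow, hsc]
        field_simp
        ring
    _ ≤ _ := by
        rw [norm_mul, Complex.norm_natCast]
        refine key2.trans (le_of_eq ?_)
        field_simp

/-! ### Second and fourth moments of independent sums -/

theorem MeasureTheory.MemLp.integrable_pow_of_le {Ω : Type*} [MeasurableSpace Ω] {P : Measure Ω}
    [IsFiniteMeasure P] {f : Ω → ℝ} {n k : ℕ} (hf : MemLp f n P) (hk : k ≤ n) :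
    Integrable (fun ω => f ω ^ k) P := by
  have hk' : MemLp f k P := hf.mono_exponent (by exact_mod_cast hk)
  refine (integrable_norm_iff (hf.1.pow k)).1 ?_
  simpa only [Pi.pow_apply, norm_pow] using hk'.integrable_norm_pow'

section Moments

variable {Ω : Type*} [MeasurableSpace Ω] {P : Measure Ω} [IsProbabilityMeasure P]

theorem ProbabilityTheory.IndepFun.integrable_pow_mul_pow {f g : Ω → ℝ} (h : IndepFun f g P)
    {n j k : ℕ} (hf : MemLp f n P) (hg : MemLp g n P) (hj : j ≤ n) (hk : k ≤ n) :
    Integrable (fun ω => f ω ^ j * g ω ^ k) P :=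
  (h.comp (measurable_id.pow_const j) (measurable_id.pow_const k)).integrable_mul
    (hf.integrable_pow_of_le hj) (hg.integrable_pow_of_le hk)

omit [IsProbabilityMeasure P] in
theorem ProbabilityTheory.IndepFun.integral_pow_mul_pow {f g : Ω → ℝ} (h : IndepFun f g P)
    (hf : AEStronglyMeasurable f P) (hg : AEStronglyMeasurable g P) (j k : ℕ) :
    ∫ ω, f ω ^ j * g ω ^ k ∂P = (∫ ω, f ω ^ j ∂P) * ∫ ω, g ω ^ k ∂P :=
  (h.comp (measurable_id.pow_const j) (measurable_id.pow_const k)).integral_fun_mul_eq_mul_integral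
    (hf.pow j) (hg.pow k)

theorem ProbabilityTheory.IndepFun.integral_add_sq {f g : Ω → ℝ} (h : IndepFun f g P)
    (hf : MemLp f 2 P) (hg : MemLp g 2 P) (hg0 : ∫ ω, g ω ∂P = 0) :
    ∫ ω, (f ω + g ω) ^ 2 ∂P = ∫ ω, f ω ^ 2 ∂P + ∫ ω, g ω ^ 2 ∂P := by
  have hi : ∀ j k : ℕ, j ≤ 2 → k ≤ 2 → Integrable (fun ω => f ω ^ j * g ω ^ k) P :=
    fun j k hj hk => h.integrable_pow_mul_pow (n := 2) hf hg hj hk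
  -- Zeroth powers are kept so that every term has the form f^j g^k and factors by the same lemma.
  have e : ∀ ω, (f ω + g ω) ^ 2
      = f ω ^ 2 * g ω ^ 0 + 2 * (f ω ^ 1 * g ω ^ 1) + f ω ^ 0 * g ω ^ 2 := fun ω => by ring
  simp_rw [e]
  rw [integral_add ((hi 2 0 (by norm_num) (by norm_num)).fun_add
      ((hi 1 1 (by norm_num) (by norm_num)).const_mul 2)) (hi 0 2 (by norm_num) (by norm_num)),
    integral_add (hi 2 0 (by norm_num) (by norm_num))
      ((hi 1 1 (by norm_num) (by norm_num)).const_mul 2), integral_const_mul]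
  simp_rw [h.integral_pow_mul_pow hf.1 hg.1]
  simp [hg0]

theorem ProbabilityTheory.IndepFun.integral_add_pow_four {f g : Ω → ℝ} (h : IndepFun f g P)
    (hf : MemLp f 4 P) (hg : MemLp g 4 P) (hf0 : ∫ ω, f ω ∂P = 0) (hg0 : ∫ ω, g ω ∂P = 0) :
    ∫ ω, (f ω + g ω) ^ 4 ∂P = ∫ ω, f ω ^ 4 ∂P + 6 * (∫ ω, f ω ^ 2 ∂P) * (∫ ω, g ω ^ 2 ∂P)
      + ∫ ω, g ω ^ 4 ∂P := by
  have hi : ∀ j k : ℕ, j ≤ 4 → k ≤ 4 → ∀ c : ℝ, Integrable (fun ω => c * (f ω ^ j * g ω ^ k)) P :=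
    fun j k hj hk c => (h.integrable_pow_mul_pow (n := 4) hf hg hj hk).const_mul c
  have e : ∀ ω, (f ω + g ω) ^ 4 = 1 * (f ω ^ 4 * g ω ^ 0) + 4 * (f ω ^ 3 * g ω ^ 1)
      + 6 * (f ω ^ 2 * g ω ^ 2) + 4 * (f ω ^ 1 * g ω ^ 3) + 1 * (f ω ^ 0 * g ω ^ 4) :=
    fun ω => by ring
  have i4 := hi 4 0 (by norm_num) (by norm_num) 1
  have i3 := hi 3 1 (by norm_num) (by norm_num) 4
  have i2 := hi 2 2 (by norm_num) (by norm_num) 6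
  have i1 := hi 1 3 (by norm_num) (by norm_num) 4
  have i0 := hi 0 4 (by norm_num) (by norm_num) 1
  simp_rw [e]
  rw [integral_add (((i4.fun_add i3).fun_add i2).fun_add i1) i0,
    integral_add ((i4.fun_add i3).fun_add i2) i1, integral_add (i4.fun_add i3) i2, integral_add i4 i3]
  simp_rw [integral_const_mul, h.integral_pow_mul_pow hf.1 hg.1]
  simp [hg0, hf0]
  ring

variable {X : ℕ → Ω → ℝ}

theorem integral_sum_range_sq (hindep : iIndepFun X P) (hm : ∀ i, Measurable (X i))
    (hX : ∀ i, MemLp (X i) 2 P) (h0 : ∀ i, ∫ ω, X i ω ∂P = 0) {v : ℝ}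
    (h2 : ∀ i, ∫ ω, X i ω ^ 2 ∂P = v) (n : ℕ) :
    ∫ ω, (∑ k ∈ Finset.range n, X k ω) ^ 2 ∂P = n * v := by
  induction n with
  | zero => simp
  | succ n ih =>
    have hind : IndepFun (fun ω => ∑ k ∈ Finset.range n, X k ω) (X n) P := by
      simpa only [Finset.sum_fn] using! hindep.indepFun_sum_range_succ hm n
    simp_rw [Finset.sum_range_succ]
    rw [hind.integral_add_sq (memLp_finsetSum _ fun i _ => hX i) (hX n) (h0 n), ih, h2]
    push_cast
    ring

/-- Adding the variable of index n contributes m + 6(nv)v, since terms with a first power vanish;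
summing 6nv² gives 3n(n - 1)v². -/
theorem integral_sum_range_pow_four (hindep : iIndepFun X P) (hm : ∀ i, Measurable (X i))
    (hX : ∀ i, MemLp (X i) 4 P) (h0 : ∀ i, ∫ ω, X i ω ∂P = 0) {v m : ℝ}
    (h2 : ∀ i, ∫ ω, X i ω ^ 2 ∂P = v) (h4 : ∀ i, ∫ ω, X i ω ^ 4 ∂P = m) (n : ℕ) :
    ∫ ω, (∑ k ∈ Finset.range n, X k ω) ^ 4 ∂P = n * m + 3 * n * (n - 1) * v ^ 2 := by
  have hX2 : ∀ i, MemLp (X i) 2 P := fun i => (hX i).mono_exponent (by norm_num)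
  induction n with
  | zero => simp
  | succ n ih =>
    have hind : IndepFun (fun ω => ∑ k ∈ Finset.range n, X k ω) (X n) P := by
      simpa only [Finset.sum_fn] using! hindep.indepFun_sum_range_succ hm n
    have hs0 : ∫ ω, ∑ k ∈ Finset.range n, X k ω ∂P = 0 := by
      rw [integral_finsetSum _ fun i _ => (hX2 i).integrable (by norm_num)]
      simp [h0]
    simp_rw [Finset.sum_range_succ]
    rw [hind.integral_add_pow_four (memLp_finsetSum _ fun i _ => hX i) (hX n) hs0 (h0 n), ih, h2,
      h4, integral_sum_range_sq hindep hm hX2 h0 h2]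
    push_cast
    ring

/-- The law of `(X 0 + ⋯ + X (n - 1)) / √n`. -/
noncomputable def normalizedSumLaw (X : ℕ → Ω → ℝ) (P : Measure Ω) (n : ℕ) : Measure ℝ :=
  P.map (fun ω => (√(n : ℝ))⁻¹ * ∑ k ∈ Finset.range n, X k ω)

omit [IsProbabilityMeasure P] in
theorem integral_normalizedSumLaw_pow (hm : ∀ i, Measurable (X i)) (n j : ℕ) :
    ∫ x, x ^ j ∂(normalizedSumLaw X P n)
      = ((√(n : ℝ))⁻¹) ^ j * ∫ ω, (∑ k ∈ Finset.range n, X k ω) ^ j ∂P := by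
  rw [normalizedSumLaw, integral_map (by fun_prop) (by fun_prop), ← integral_const_mul]
  simp_rw [mul_pow]

theorem integrable_normalizedSumLaw_pow {m : ℕ} (hm : ∀ i, Measurable (X i))
    (hX : ∀ i, MemLp (X i) m P) (n : ℕ) {j : ℕ} (hj : j ≤ m) :
    Integrable (fun x => x ^ j) (normalizedSumLaw X P n) := by
  rw [normalizedSumLaw, integrable_map_measure (by fun_prop) (by fun_prop)]
  exact ((memLp_finsetSum _ fun i _ => hX i).const_mul _).integrable_pow_of_le hj

theorem integral_normalizedSumLaw_sq (hindep : iIndepFun X P) (hm : ∀ i, Measurable (X i))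
    (hX : ∀ i, MemLp (X i) 2 P) (h0 : ∀ i, ∫ ω, X i ω ∂P = 0)
    (h2 : ∀ i, ∫ ω, X i ω ^ 2 ∂P = 1) {n : ℕ} (hn : n ≠ 0) :
    ∫ x, x ^ 2 ∂(normalizedSumLaw X P n) = 1 := by
  rw [integral_normalizedSumLaw_pow hm, integral_sum_range_sq hindep hm hX h0 h2, inv_pow,
    Real.sq_sqrt (Nat.cast_nonneg n)]
  field_simp

theorem integral_normalizedSumLaw_pow_four (hindep : iIndepFun X P) (hm : ∀ i, Measurable (X i))
    (hX : ∀ i, MemLp (X i) 4 P) (h0 : ∀ i, ∫ ω, X i ω ∂P = 0) {m : ℝ}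
    (h2 : ∀ i, ∫ ω, X i ω ^ 2 ∂P = 1) (h4 : ∀ i, ∫ ω, X i ω ^ 4 ∂P = m) {n : ℕ} (hn : n ≠ 0) :
    ∫ x, x ^ 4 ∂(normalizedSumLaw X P n) = 3 + (m - 3) / n := by
  rw [integral_normalizedSumLaw_pow hm, integral_sum_range_pow_four hindep hm hX h0 h2 h4, inv_pow,
    show √(n : ℝ) ^ 4 = (√(n : ℝ) ^ 2) ^ 2 by ring, Real.sq_sqrt (Nat.cast_nonneg n)]
  field_simp
  ring

end Moments

/-! ### Gaussian fourth moment -/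

theorem integral_pow_four_gaussianReal : ∫ x, x ^ 4 ∂(gaussianReal 0 1) = 3 := by
  have h := iteratedDeriv_mgf_zero (X := fun x : ℝ => x) (μ := gaussianReal 0 1) (by simp) 4
  rw [Pi.pow_def] at h
  rw [← h, mgf_fun_id_gaussianReal]
  -- Differentiation acts on the polynomial factor by p ↦ p' + tp. Four applications to 1 give t⁴ +
  -- 6t² + 3, evaluated at 0.
  have step : ∀ p : Polynomial ℝ, deriv (fun t => p.eval t * Real.exp (t ^ 2 / 2))
      = fun t => (p.derivative + Polynomial.X * p).eval t * Real.exp (t ^ 2 / 2) := by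
    intro p
    ext t
    have h1 : HasDerivAt (fun t : ℝ => t ^ 2 / 2) t t := by
      simpa using (hasDerivAt_pow 2 t).div_const 2
    rw [((p.hasDerivAt t).fun_mul h1.exp).deriv]
    simp only [Polynomial.eval_add, Polynomial.eval_mul, Polynomial.eval_X]
    ring
  have e0 : (fun t : ℝ => Real.exp (((0 : ℝ) * t) + ((1 : NNReal) : ℝ) * t ^ 2 / 2))
      = fun t => (1 : Polynomial ℝ).eval t * Real.exp (t ^ 2 / 2) := by
    ext t; simp
  rw [e0, iteratedDeriv_succ, iteratedDeriv_succ, iteratedDeriv_succ, iteratedDeriv_one,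
    step, step, step, step]
  simp
  norm_num

/-! ### Independence and equality in law of block sums -/

section Blocks

variable {Ω ι : Type*} [MeasurableSpace Ω] {P : Measure Ω} [IsProbabilityMeasure P]

theorem charFun_map_sum_comp_sum_of_pairwiseDisjoint {α : Type*} {X : ι → Ω → ℝ}
    (hindep : iIndepFun X P) (hm : ∀ i, Measurable (X i)) {S : α → Finset ι} {A : Finset α}
    (hS : (A : Set α).PairwiseDisjoint S) {g : ℝ → ℝ} (hg : Measurable g) (t : ℝ) :
    charFun (P.map fun ω => ∑ a ∈ A, g (∑ i ∈ S a, X i ω)) t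
      = ∏ a ∈ A, charFun (P.map fun ω => g (∑ i ∈ S a, X i ω)) t := by
  classical
  induction A using Finset.induction with
  | empty => simp
  | insert a A ha ih =>
    have hdisj : Disjoint (S a) (A.biUnion S) := by
      rw [Finset.disjoint_biUnion_right]
      intro b hb
      exact hS (by simp) (by simp [hb]) fun hab => ha (hab ▸ hb)
    have hind := (hindep.indepFun_finset _ _ hdisj hm).comp
      (φ := fun x : S a → ℝ => g (∑ i, x i))
      -- The default 0 is never used: S b lies in the union for every b in A.
      (ψ := fun y : A.biUnion S → ℝ => ∑ b ∈ A, g (∑ i ∈ S b,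
        if h : i ∈ A.biUnion S then y ⟨i, h⟩ else 0))
      (by fun_prop) (by
        refine Finset.measurable_sum _ fun b _ => hg.comp (Finset.measurable_sum _ fun i _ => ?_)
        split_ifs <;> fun_prop)
    have hind' : IndepFun (fun ω => g (∑ i ∈ S a, X i ω))
        (fun ω => ∑ b ∈ A, g (∑ i ∈ S b, X i ω)) P := by
      convert hind using 1
      · ext ω
        simp only [Function.comp_apply]
        rw [← Finset.sum_coe_sort]
      · ext ω
        simp only [Function.comp_apply]
        refine Finset.sum_congr rfl fun b hb => congrArg g (Finset.sum_congr rfl fun i hi => ?_)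
        rw [dif_pos (Finset.mem_biUnion.2 ⟨b, hb, hi⟩)]
    simp_rw [Finset.sum_insert ha]
    rw [hind'.charFun_map_fun_add_eq_mul (by fun_prop) (by fun_prop), Pi.mul_apply,
      Finset.prod_insert ha, ih (hS.subset (by simp))]

/-- Both characteristic functions are that of ν to the power of the cardinality. This replaces a
two-dimensional block by an initial segment of a sequence. -/
theorem map_sum_eq_map_sum_of_card_eq {κ : Type*} {X : ι → Ω → ℝ} {X' : κ → Ω → ℝ} {ν : Measure ℝ}
    (hindep : iIndepFun X P) (hm : ∀ i, Measurable (X i)) (hX : ∀ i, P.map (X i) = ν)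
    (hindep' : iIndepFun X' P) (hm' : ∀ i, Measurable (X' i)) (hX' : ∀ i, P.map (X' i) = ν)
    {S : Finset ι} {S' : Finset κ} (hS : S.card = S'.card) :
    P.map (fun ω => ∑ i ∈ S, X i ω) = P.map (fun ω => ∑ i ∈ S', X' i ω) := by
  have : IsProbabilityMeasure (P.map fun ω => ∑ i ∈ S, X i ω) :=
    Measure.isProbabilityMeasure_map (by fun_prop)
  have : IsProbabilityMeasure (P.map fun ω => ∑ i ∈ S', X' i ω) :=
    Measure.isProbabilityMeasure_map (by fun_prop)
  apply Measure.ext_of_charFun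
  rw [(hindep.restrict _).charFun_map_fun_finsetSum_eq_prod fun i _ => (hm i).aemeasurable,
    (hindep'.restrict _).charFun_map_fun_finsetSum_eq_prod fun i _ => (hm' i).aemeasurable]
  simp [hX, hX', hS]

end Blocks

/-! ### CLT for squared normalized sums -/

section Limit

open Topology

variable {Ω : Type*} [MeasurableSpace Ω] {P : Measure Ω} [IsProbabilityMeasure P]

/-- For iid standardized `X k`, the sum of `B` independent copies of
`((X 0 + ⋯ + X (M - 1)) / √M) ^ 2 - 1`, divided by its standard deviation, is asymptotically
standard normal as `M, B → ∞`. -/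
theorem tendsto_charFun_sq_normalizedSum_pow {X : ℕ → Ω → ℝ} (hindep : iIndepFun X P)
    (hm : ∀ i, Measurable (X i)) (hident : ∀ i, IdentDistrib (X i) (X 0) P P)
    (hX : ∀ i, MemLp (X i) 4 P) (h0 : ∀ i, ∫ ω, X i ω ∂P = 0)
    (h2 : ∀ i, ∫ ω, X i ω ^ 2 ∂P = 1) {m : ℝ} (h4 : ∀ i, ∫ ω, X i ω ^ 4 ∂P = m)
    {ι : Type*} {l : Filter ι} {M B : ι → ℕ} (hM : Tendsto M l atTop) (hB : Tendsto B l atTop)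
    (t : ℝ) :
    Tendsto (fun i => charFun ((normalizedSumLaw X P (M i)).map fun x => x ^ 2 - 1)
        ((√(2 + (m - 3) / M i))⁻¹ * t * (√(B i : ℝ))⁻¹) ^ B i) l
      (𝓝 (Complex.exp (-(t ^ 2 / 2 : ℝ)))) := by
  have hX2 : ∀ i, MemLp (X i) 2 P := fun i => (hX i).mono_exponent (by norm_num)
  have hg : Continuous fun x : ℝ => x ^ 2 - 1 := by fun_prop
  have hρ : ∀ n, IsProbabilityMeasure (normalizedSumLaw X P n) := fun n =>
    Measure.isProbabilityMeasure_map (by fun_prop)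
  let μ : ℕ → ProbabilityMeasure ℝ := fun n =>
    ⟨(normalizedSumLaw X P n).map fun x => x ^ 2 - 1,
      Measure.isProbabilityMeasure_map hg.measurable.aemeasurable⟩
  let ν : ProbabilityMeasure ℝ := ⟨(gaussianReal 0 1).map fun x => x ^ 2 - 1,
    Measure.isProbabilityMeasure_map hg.measurable.aemeasurable⟩
  -- Classical CLT followed by the continuous mapping theorem for x ↦ x² - 1.
  have hμ : Tendsto μ atTop (𝓝 ν) := by
    have h := tendstoInDistribution_inv_sqrt_mul_sum (P := P) (X := X) (Y := id)
      (P' := gaussianReal 0 1) ⟨aemeasurable_id, Measure.map_id⟩ (h0 0)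
      (by simpa only [Pi.pow_apply] using h2 0) hindep hident
    have hc := (h.continuous_comp hg).tendsto
    refine hc.congr fun n => Subtype.ext ?_
    change _ = (normalizedSumLaw X P n).map _
    rw [normalizedSumLaw, Measure.map_map hg.measurable (by fun_prop)]
  have hint : ∀ {m : Measure ℝ} [IsProbabilityMeasure m], (∀ j ≤ 4, Integrable (fun x => x ^ j) m) →
      Integrable (fun x => x ^ 2) (m.map fun x => x ^ 2 - 1) := by
    intro m _ hj
    rw [integrable_map_measure (by fun_prop) (by fun_prop)]
    refine (((hj 4 le_rfl).sub ((hj 2 (by norm_num)).const_mul 2)).add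
      (integrable_const (1 : ℝ))).congr (ae_of_all _ fun x => ?_)
    simp only [Pi.add_apply, Pi.sub_apply, Function.comp_apply]
    ring
  have hsq : ∀ {m : Measure ℝ} [IsProbabilityMeasure m], (∀ j ≤ 4, Integrable (fun x => x ^ j) m) →
      ∫ x, x ^ 2 ∂m = 1 →
      ∫ x, x ^ 2 ∂(m.map fun x => x ^ 2 - 1) = ∫ x, x ^ 4 ∂m - 1 := by
    intro m _ hj h2m
    have hi : Integrable (fun x : ℝ => x ^ 4 - 2 * x ^ 2) m :=
      (hj 4 le_rfl).sub ((hj 2 (by norm_num)).const_mul 2)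
    rw [integral_map (by fun_prop) (by fun_prop)]
    calc ∫ x : ℝ, (x ^ 2 - 1) ^ 2 ∂m = ∫ x : ℝ, (x ^ 4 - 2 * x ^ 2 + 1) ∂m := by
          congr 1; ext x; ring
      _ = _ := by
          rw [integral_add hi (integrable_const _), integral_sub (hj 4 le_rfl) ((hj 2 (by norm_num)).const_mul 2),
            integral_const_mul, h2m]
          simp
          ring
  have hγ : ∀ j ≤ 4, Integrable (fun x : ℝ => x ^ j) (gaussianReal 0 1) := fun j hj =>
    MemLp.integrable_pow_of_le (n := 4) (memLp_id_gaussianReal 4) hj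
  have hγ2 : ∫ x, x ^ 2 ∂(gaussianReal 0 1) = 1 := by
    have := variance_fun_id_gaussianReal (μ := 0) (v := 1)
    rw [variance_eq_integral (by fun_prop)] at this
    simpa using this
  have hρj : ∀ n, ∀ j ≤ 4, Integrable (fun x : ℝ => x ^ j) (normalizedSumLaw X P n) :=
    fun n j hj => integrable_normalizedSumLaw_pow (m := 4) hm hX n hj
  have hν2 : ∫ x, x ^ 2 ∂(ν : Measure ℝ) = 2 := by
    refine (hsq hγ hγ2).trans ?_
    rw [integral_pow_four_gaussianReal]
    norm_num
  have hμ2 : ∀ n : ℕ, n ≠ 0 → ∫ x, x ^ 2 ∂(μ n : Measure ℝ) = 2 + (m - 3) / n := by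
    intro n hn
    refine (hsq (hρj n) (integral_normalizedSumLaw_sq hindep hm hX2 h0 h2 hn)).trans ?_
    rw [integral_normalizedSumLaw_pow_four hindep hm hX h0 h2 h4 hn]
    ring
  have hμ0 : ∀ n : ℕ, n ≠ 0 → ∫ x, x ∂(μ n : Measure ℝ) = 0 := by
    intro n hn
    change ∫ x, x ∂((normalizedSumLaw X P n).map fun x => x ^ 2 - 1) = 0
    rw [integral_map (by fun_prop) (by fun_prop), integral_sub (hρj n 2 (by norm_num))
      (integrable_const _), integral_normalizedSumLaw_sq hindep hm hX2 h0 h2 hn]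
    simp
  have hM0 : ∀ᶠ i in l, M i ≠ 0 := hM.eventually_ne_atTop 0
  have hκ : Tendsto (fun i => 2 + (m - 3) / (M i : ℝ)) l (𝓝 2) := by
    have := ((tendsto_const_nhds (x := m - 3)).div_atTop
      (tendsto_natCast_atTop_atTop (R := ℝ))).comp hM
    simpa using this.const_add 2
  have key := tendsto_charFun_pow_of_tendsto (hμ.comp hM)
    (Eventually.of_forall fun i => hint (hρj (M i)))
    (hM0.mono fun i hi => hμ0 _ hi) (hint hγ)
    (by
      rw [hν2]
      refine hκ.congr' ?_
      filter_upwards [hM0] with i hi using (hμ2 _ hi).symm)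
    hB (t := fun i => (√(2 + (m - 3) / M i))⁻¹ * t) (t₀ := (√2)⁻¹ * t)
    (((Real.continuous_sqrt.tendsto _ |>.comp hκ).inv₀ (by positivity)).mul_const t)
  have hval : ((√2)⁻¹ * t) ^ 2 * ∫ x, x ^ 2 ∂(ν : Measure ℝ) = t ^ 2 := by
    rw [hν2, mul_pow, inv_pow, Real.sq_sqrt (by norm_num)]
    ring
  rw [hval] at key
  exact key

end Limit

/-! ### Block geometry and algebra of the statistic -/

section Statistic

variable {Ω : Type*} [MeasurableSpace Ω] {P : Measure Ω}

theorem fourthStdMoment_of_integral_eq_zero {Z : Ω → ℝ} (hZ : AEMeasurable Z P)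
    (h0 : ∫ ω, Z ω ∂P = 0) :
    fourthStdMoment Z P = (∫ ω, Z ω ^ 4 ∂P) / (∫ ω, Z ω ^ 2 ∂P) ^ 2 := by
  rw [fourthStdMoment, centralMoment, variance_eq_integral hZ, h0]
  simp

/-- The block `(h, k)` in terms of indices starting at `0`. -/
def shiftedBlock (l₁ l₂ : ℕ) (a : ℕ × ℕ) : Finset (ℕ × ℕ) :=
  Finset.Ico ((a.1 - 1) * l₁) (a.1 * l₁) ×ˢ Finset.Ico ((a.2 - 1) * l₂) (a.2 * l₂)

theorem card_shiftedBlock (l₁ l₂ : ℕ) {a : ℕ × ℕ} (h₁ : 1 ≤ a.1) (h₂ : 1 ≤ a.2) :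
    (shiftedBlock l₁ l₂ a).card = l₁ * l₂ := by
  have : ∀ h l : ℕ, 1 ≤ h → h * l - (h - 1) * l = l := fun h l hh => by
    rw [← Nat.sub_mul, Nat.sub_sub_self hh, one_mul]
  rw [shiftedBlock, Finset.card_product, Nat.card_Ico, Nat.card_Ico, this _ _ h₁, this _ _ h₂]

theorem eq_of_mem_Ico_mul {l h h' x : ℕ} (hh : 1 ≤ h) (hh' : 1 ≤ h')
    (hx : x ∈ Finset.Ico ((h - 1) * l) (h * l)) (hx' : x ∈ Finset.Ico ((h' - 1) * l) (h' * l)) :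
    h = h' := by
  obtain ⟨k, rfl⟩ := Nat.exists_eq_add_of_le' hh
  obtain ⟨k', rfl⟩ := Nat.exists_eq_add_of_le' hh'
  simp only [Nat.add_sub_cancel, Finset.mem_Ico] at hx hx'
  have h1 := lt_of_mul_lt_mul_right (hx.1.trans_lt hx'.2) (Nat.zero_le l)
  have h2 := lt_of_mul_lt_mul_right (hx'.1.trans_lt hx.2) (Nat.zero_le l)
  omega

theorem pairwiseDisjoint_shiftedBlock (l₁ l₂ b₁ b₂ : ℕ) :
    ((Finset.Icc 1 b₁ ×ˢ Finset.Icc 1 b₂ : Finset (ℕ × ℕ)) : Set (ℕ × ℕ)).PairwiseDisjoint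
      (shiftedBlock l₁ l₂) := by
  intro a ha b hb hab
  simp only [Finset.coe_product, Finset.coe_Icc, Set.mem_prod, Set.mem_Icc] at ha hb
  refine Finset.disjoint_left.2 fun x hx hx' => hab ?_
  rw [shiftedBlock, Finset.mem_product] at hx hx'
  exact Prod.ext (eq_of_mem_Ico_mul ha.1.1 hb.1.1 hx.1 hx'.1)
    (eq_of_mem_Ico_mul ha.2.1 hb.2.1 hx.2 hx'.2)

theorem sum_blockIndices_eq_sum_shiftedBlock (f : ℕ → ℕ → ℝ) (l₁ l₂ h k : ℕ) :
    ∑ p ∈ blockIndices l₁ l₂ h k, f p.1 p.2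
      = ∑ p ∈ shiftedBlock l₁ l₂ (h, k), f (p.1 + 1) (p.2 + 1) := by
  symm
  refine Finset.sum_nbij' (fun p => (p.1 + 1, p.2 + 1)) (fun p => (p.1 - 1, p.2 - 1)) ?_ ?_ ?_ ?_ ?_
  · rintro ⟨x, y⟩
    simp only [shiftedBlock, blockIndices, Finset.mem_product, Finset.mem_Ico, Finset.mem_Icc]
    omega
  · rintro ⟨x, y⟩
    simp only [shiftedBlock, blockIndices, Finset.mem_product, Finset.mem_Ico, Finset.mem_Icc]
    omega
  · rintro ⟨x, y⟩ _
    simp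
  · rintro ⟨x, y⟩
    simp only [blockIndices, Finset.mem_product, Finset.mem_Icc, Prod.mk.injEq]
    omega
  · intros
    rfl

theorem sum_Icc_sum_Icc_eq_sum_shiftedBlock (f : ℕ → ℕ → ℝ) (a b : ℕ) :
    ∑ i ∈ Finset.Icc 1 a, ∑ j ∈ Finset.Icc 1 b, f i j
      = ∑ p ∈ shiftedBlock a b (1, 1), f (p.1 + 1) (p.2 + 1) := by
  rw [← sum_blockIndices_eq_sum_shiftedBlock, ← Finset.sum_product', blockIndices]
  simp

theorem measurable_blockStatistic {Y : ℕ → ℕ → Ω → ℝ}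
    (hmeas : ∀ i j, 1 ≤ i → 1 ≤ j → Measurable (Y i j)) (σ : ℝ) (l₁ l₂ b₁ b₂ : ℕ) :
    Measurable (blockStatistic Y P σ l₁ l₂ b₁ b₂) := by
  refine Measurable.const_mul (Measurable.sub_const (Measurable.const_mul ?_ _) _) _
  refine Finset.measurable_sum _ fun h _ => Finset.measurable_sum _ fun k _ =>
    Measurable.pow_const (Measurable.const_mul (Measurable.const_mul
      (Finset.measurable_sum _ fun p hp => ?_) _) _) _
  rw [blockIndices, Finset.mem_product, Finset.mem_Icc, Finset.mem_Icc] at hp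
  exact hmeas _ _ (by omega) (by omega)

/-- The statistic as a normalized sum over blocks of centred squares of standardized block sums. -/
theorem blockStatistic_eq {Y : ℕ → ℕ → Ω → ℝ} {σ : ℝ} (hσ : σ ≠ 0) {l₁ l₂ b₁ b₂ : ℕ}
    (hl : l₁ * l₂ ≠ 0) (hb : b₁ * b₂ ≠ 0) (ω : Ω) :
    blockStatistic Y P σ l₁ l₂ b₁ b₂ ω
      = (√(kappa4 Y P l₁ l₂ - 1))⁻¹ * (√((b₁ * b₂ : ℕ) : ℝ))⁻¹ *
        ∑ a ∈ Finset.Icc 1 b₁ ×ˢ Finset.Icc 1 b₂,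
          (((√((l₁ * l₂ : ℕ) : ℝ))⁻¹ *
            ∑ p ∈ shiftedBlock l₁ l₂ a, σ⁻¹ * Y (p.1 + 1) (p.2 + 1) ω) ^ 2 - 1) := by
  have hl' : ((l₁ : ℝ) * l₂) ≠ 0 := by exact_mod_cast hl
  have hb' : ((b₁ : ℝ) * b₂) ≠ 0 := by exact_mod_cast hb
  have hl0 : 0 ≤ ((l₁ : ℝ) * l₂) := by positivity
  have hb0 : 0 ≤ ((b₁ : ℝ) * b₂) := by positivity
  have hsb : √((b₁ : ℝ) * b₂) ≠ 0 := Real.sqrt_ne_zero'.2 (hb0.lt_of_ne' hb')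
  have hblock : ∀ h k, normBlockMean Y l₁ l₂ h k ω ^ 2
      = σ ^ 2 * ((√((l₁ : ℝ) * l₂))⁻¹ *
            ∑ p ∈ shiftedBlock l₁ l₂ (h, k), σ⁻¹ * Y (p.1 + 1) (p.2 + 1) ω) ^ 2 := by
    intro h k
    rw [normBlockMean, blockMean, sum_blockIndices_eq_sum_shiftedBlock (fun i j => Y i j ω),
      ← Finset.mul_sum, mul_pow, mul_pow, mul_pow, mul_pow, inv_pow, inv_pow, Real.sq_sqrt hl0]
    field_simp
  simp only [blockStatistic, Nat.cast_mul]
  simp_rw [hblock]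
  rw [Finset.sum_sub_distrib, Finset.sum_product]
  simp_rw [← Finset.mul_sum]
  simp only [Finset.sum_const, Finset.card_product, Nat.card_Icc, Nat.add_sub_cancel, nsmul_eq_mul,
    Nat.cast_mul, mul_one]
  -- The subtracted root is the normalized sum of one 1 per block, so it centres each square.
  have e : √((b₁ : ℝ) * b₂) = (√((b₁ : ℝ) * b₂))⁻¹ * ((b₁ : ℝ) * b₂) := by
    rw [eq_inv_mul_iff_mul_eq₀ hsb, Real.mul_self_sqrt hb0]
  rw [one_div, mul_assoc]
  congr 1
  rw [mul_sub, ← e]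
  congr 1
  field_simp

end Statistic

/-! ### Growth of block sizes and block counts -/

section BlockLengths

/-- Since n^s ≥ 1, rounding leaves l > 0, so n^s < l + 1 ≤ 2l. -/
theorem rpow_le_two_mul_blockLength {s : ℝ} (hs : 0 ≤ s) {n l : ℕ} (hn : 1 ≤ n)
    (hl : |(l : ℝ) - (n : ℝ) ^ s| < 1) : (n : ℝ) ^ s ≤ 2 * l := by
  have hn' : (1 : ℝ) ≤ (n : ℝ) ^ s := Real.one_le_rpow (by exact_mod_cast hn) hs
  have h := (abs_lt.1 hl).1
  have hl1 : 1 ≤ l := Nat.one_le_iff_ne_zero.2 fun h0 => by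
    rw [h0] at h
    push_cast at h
    linarith
  have : (1 : ℝ) ≤ l := by exact_mod_cast hl1
  linarith

/-- Rounding gives l < n + 1, so l ≤ n and b ≥ 1. Then n < l(b + 1) with l ≤ 2n^s and b + 1 ≤ 2b,
whence the 4. -/
theorem rpow_le_four_mul_numBlocks {s : ℝ} (hs₀ : 0 ≤ s) (hs₁ : s ≤ 1) {n l : ℕ} (hn : 1 ≤ n)
    (hl : |(l : ℝ) - (n : ℝ) ^ s| < 1) : (n : ℝ) ^ (1 - s) ≤ 4 * numBlocks l n := by
  have hn1 : (1 : ℝ) ≤ n := by exact_mod_cast hn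
  have hns : (1 : ℝ) ≤ (n : ℝ) ^ s := Real.one_le_rpow hn1 hs₀
  have hns' : (n : ℝ) ^ s ≤ n := (Real.rpow_le_rpow_of_exponent_le hn1 hs₁).trans_eq (Real.rpow_one _)
  have hlow := rpow_le_two_mul_blockLength hs₀ hn hl
  have h := (abs_lt.1 hl).2
  have hl0 : 0 < l := Nat.pos_of_ne_zero fun h0 => by
    rw [h0] at hlow
    push_cast at hlow
    linarith
  have hln : l ≤ n := by
    have : (l : ℝ) < n + 1 := by linarith
    exact Nat.lt_succ_iff.1 (by exact_mod_cast this)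
  have hb1 : 1 ≤ numBlocks l n := (Nat.one_le_div_iff hl0).2 hln
  have hb : n < l * (numBlocks l n + 1) := Nat.lt_mul_div_succ n hl0
  have hb' : (n : ℝ) ≤ l * (numBlocks l n + 1) := by exact_mod_cast hb.le
  have hb1' : (1 : ℝ) ≤ numBlocks l n := by exact_mod_cast hb1
  rw [Real.rpow_sub (by linarith), Real.rpow_one, div_le_iff₀ (by linarith)]
  calc (n : ℝ) ≤ l * (numBlocks l n + 1) := hb'
    _ ≤ (2 * (n : ℝ) ^ s) * (2 * numBlocks l n) := by gcongr <;> linarith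
    _ = _ := by ring

/-- The bounds hold from n = 1 on, not just asymptotically, so f(n)g(m) ≥ c⁻²(nm)^min(s₁, s₂) even
when one index stays bounded. -/
theorem tendsto_mul_comap_mul_atTop {f g : ℕ → ℕ} {c s₁ s₂ : ℝ} (hc : 0 < c) (hs₁ : 0 < s₁)
    (hs₂ : 0 < s₂) (hf : ∀ n : ℕ, 1 ≤ n → (n : ℝ) ^ s₁ ≤ c * f n)
    (hg : ∀ n : ℕ, 1 ≤ n → (n : ℝ) ^ s₂ ≤ c * g n) :
    Tendsto (fun q : ℕ × ℕ => f q.1 * g q.2) (comap (fun q : ℕ × ℕ => q.1 * q.2) atTop) atTop := by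
  have hδ : 0 < min s₁ s₂ := lt_min hs₁ hs₂
  rw [← tendsto_natCast_atTop_iff (R := ℝ)]
  have hlim : Tendsto (fun q : ℕ × ℕ => (c ^ 2)⁻¹ * ((q.1 * q.2 : ℕ) : ℝ) ^ min s₁ s₂)
      (comap (fun q : ℕ × ℕ => q.1 * q.2) atTop) atTop :=
    Tendsto.const_mul_atTop (by positivity) ((tendsto_rpow_atTop hδ).comp
      (tendsto_natCast_atTop_atTop.comp tendsto_comap))
  refine tendsto_atTop_mono' _ ?_ hlim
  filter_upwards [tendsto_comap.eventually_ge_atTop 1] with q hq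
  have h1 : 1 ≤ q.1 := Nat.pos_of_mul_pos_right hq
  have h2 : 1 ≤ q.2 := Nat.pos_of_mul_pos_left hq
  rw [inv_mul_le_iff₀ (by positivity)]
  push_cast
  rw [Real.mul_rpow (Nat.cast_nonneg _) (Nat.cast_nonneg _)]
  have h1' : (1 : ℝ) ≤ q.1 := by exact_mod_cast h1
  have h2' : (1 : ℝ) ≤ q.2 := by exact_mod_cast h2
  calc (q.1 : ℝ) ^ min s₁ s₂ * (q.2 : ℝ) ^ min s₁ s₂ ≤ (q.1 : ℝ) ^ s₁ * (q.2 : ℝ) ^ s₂ := by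
        gcongr
        · exact min_le_left _ _
        · exact min_le_right _ _
    _ ≤ (c * f q.1) * (c * g q.2) := by
        gcongr
        · exact hf _ h1
        · exact hg _ h2
    _ = _ := by ring

end BlockLengths

/-! ### Kurtosis and characteristic function of the statistic -/

section Characteristic

variable {Ω : Type*} [MeasurableSpace Ω] {P : Measure Ω} [IsProbabilityMeasure P]

theorem map_normalized_sum_shiftedBlock {X : ℕ × ℕ → Ω → ℝ} (hindep : iIndepFun X P)
    (hm : ∀ p, Measurable (X p)) (hX : ∀ p, P.map (X p) = P.map (X (0, 0))) (l₁ l₂ : ℕ)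
    {a : ℕ × ℕ} (h₁ : 1 ≤ a.1) (h₂ : 1 ≤ a.2) :
    P.map (fun ω => (√((l₁ * l₂ : ℕ) : ℝ))⁻¹ * ∑ p ∈ shiftedBlock l₁ l₂ a, X p ω)
      = normalizedSumLaw (fun k => X (0, k)) P (l₁ * l₂) := by
  have hlaw : P.map (fun ω => ∑ p ∈ shiftedBlock l₁ l₂ a, X p ω)
      = P.map (fun ω => ∑ k ∈ Finset.range (l₁ * l₂), X (0, k) ω) :=
    map_sum_eq_map_sum_of_card_eq hindep hm hX
      (hindep.precomp (g := fun k : ℕ => (0, k)) fun _ _ h => (Prod.ext_iff.1 h).2)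
      (fun k => hm (0, k)) (fun k => hX (0, k))
      (by rw [card_shiftedBlock _ _ h₁ h₂, Finset.card_range])
  have h := congrArg (Measure.map fun x => (√((l₁ * l₂ : ℕ) : ℝ))⁻¹ * x) hlaw
  rwa [Measure.map_map (by fun_prop) (by fun_prop),
    Measure.map_map (by fun_prop) (by fun_prop)] at h

/-- The standardized moment is scale invariant, so σ cancels and the moments of the normalized sum
law remain. -/
theorem kappa4_eq {Y : ℕ → ℕ → Ω → ℝ} {σ : ℝ} (hσ : σ ≠ 0) {X : ℕ × ℕ → Ω → ℝ}
    (hXY : ∀ p, X p = fun ω => σ⁻¹ * Y (p.1 + 1) (p.2 + 1) ω)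
    (hindep : iIndepFun X P) (hm : ∀ p, Measurable (X p))
    (hX : ∀ p, P.map (X p) = P.map (X (0, 0))) (hX4 : ∀ p, MemLp (X p) 4 P)
    (h0 : ∀ p, ∫ ω, X p ω ∂P = 0) (h2 : ∀ p, ∫ ω, X p ω ^ 2 ∂P = 1) {m : ℝ}
    (h4 : ∀ p, ∫ ω, X p ω ^ 4 ∂P = m) {l₁ l₂ : ℕ} (hl : l₁ * l₂ ≠ 0) :
    kappa4 Y P l₁ l₂ = 3 + (m - 3) / (l₁ * l₂ : ℕ) := by
  have hindep' : iIndepFun (fun k : ℕ => X (0, k)) P :=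
    hindep.precomp (g := fun k : ℕ => (0, k)) fun _ _ h => (Prod.ext_iff.1 h).2
  have hZ : (fun ω => 1 / √((l₁ : ℝ) * l₂) *
      ∑ i ∈ Finset.Icc 1 l₁, ∑ j ∈ Finset.Icc 1 l₂, Y i j ω)
      = fun ω => σ * ((√((l₁ * l₂ : ℕ) : ℝ))⁻¹ * ∑ p ∈ shiftedBlock l₁ l₂ (1, 1), X p ω) := by
    ext ω
    rw [sum_Icc_sum_Icc_eq_sum_shiftedBlock (fun i j => Y i j ω)]
    simp_rw [hXY]
    rw [← Finset.mul_sum]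
    push_cast
    field_simp
  have hmom : ∀ j : ℕ, ∫ ω, ((√((l₁ * l₂ : ℕ) : ℝ))⁻¹ *
      ∑ p ∈ shiftedBlock l₁ l₂ (1, 1), X p ω) ^ j ∂P
      = ∫ x, x ^ j ∂(normalizedSumLaw (fun k => X (0, k)) P (l₁ * l₂)) := by
    intro j
    rw [← map_normalized_sum_shiftedBlock hindep hm hX l₁ l₂ (a := (1, 1)) le_rfl le_rfl,
      integral_map (by fun_prop) (by fun_prop)]
  have hmean : ∫ ω, (√((l₁ * l₂ : ℕ) : ℝ))⁻¹ * ∑ p ∈ shiftedBlock l₁ l₂ (1, 1), X p ω ∂P = 0 := by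
    rw [integral_const_mul, integral_finsetSum _ fun p _ => (hX4 p).integrable (by norm_num)]
    simp [h0]
  rw [kappa4, hZ, fourthStdMoment_of_integral_eq_zero (by fun_prop)
    (by rw [integral_const_mul, hmean, mul_zero])]
  simp_rw [mul_pow σ, integral_const_mul, hmom]
  rw [integral_normalizedSumLaw_sq hindep' (fun k => hm _)
      (fun k => (hX4 (0, k)).mono_exponent (by norm_num)) (fun k => h0 _) (fun k => h2 _) hl,
    integral_normalizedSumLaw_pow_four hindep' (fun k => hm _) (fun k => hX4 _) (fun k => h0 _)
      (fun k => h2 _) (fun k => h4 _) hl]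
  field_simp

theorem charFun_map_blockStatistic {Y : ℕ → ℕ → Ω → ℝ} {σ : ℝ} (hσ : σ ≠ 0) {X : ℕ × ℕ → Ω → ℝ}
    (hXY : ∀ p, X p = fun ω => σ⁻¹ * Y (p.1 + 1) (p.2 + 1) ω)
    (hindep : iIndepFun X P) (hm : ∀ p, Measurable (X p))
    (hX : ∀ p, P.map (X p) = P.map (X (0, 0))) {l₁ l₂ b₁ b₂ : ℕ} (hl : l₁ * l₂ ≠ 0)
    (hb : b₁ * b₂ ≠ 0) (t : ℝ) :
    charFun (P.map (blockStatistic Y P σ l₁ l₂ b₁ b₂)) t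
      = charFun ((normalizedSumLaw (fun k => X (0, k)) P (l₁ * l₂)).map fun x => x ^ 2 - 1)
          ((√(kappa4 Y P l₁ l₂ - 1))⁻¹ * t * (√((b₁ * b₂ : ℕ) : ℝ))⁻¹) ^ (b₁ * b₂) := by
  have hstat : blockStatistic Y P σ l₁ l₂ b₁ b₂ = fun ω =>
      ((√(kappa4 Y P l₁ l₂ - 1))⁻¹ * (√((b₁ * b₂ : ℕ) : ℝ))⁻¹) *
        ∑ a ∈ Finset.Icc 1 b₁ ×ˢ Finset.Icc 1 b₂,
          (((√((l₁ * l₂ : ℕ) : ℝ))⁻¹ * ∑ p ∈ shiftedBlock l₁ l₂ a, X p ω) ^ 2 - 1) := by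
    ext ω
    simp_rw [hXY]
    exact blockStatistic_eq hσ hl hb ω
  rw [hstat, charFun_map_mul_comp (by fun_prop),
    charFun_map_sum_comp_sum_of_pairwiseDisjoint hindep hm
      (pairwiseDisjoint_shiftedBlock l₁ l₂ b₁ b₂)
      (g := fun x => ((√((l₁ * l₂ : ℕ) : ℝ))⁻¹ * x) ^ 2 - 1) (by fun_prop),
    Finset.prod_eq_pow_card (b := charFun ((normalizedSumLaw (fun k => X (0, k)) P (l₁ * l₂)).map
      fun x => x ^ 2 - 1) ((√(kappa4 Y P l₁ l₂ - 1))⁻¹ * t * (√((b₁ * b₂ : ℕ) : ℝ))⁻¹))]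
  · simp
  · intro a ha
    rw [Finset.mem_product, Finset.mem_Icc, Finset.mem_Icc] at ha
    rw [← map_normalized_sum_shiftedBlock hindep hm hX l₁ l₂ ha.1.1 ha.2.1,
      Measure.map_map (by fun_prop) (by fun_prop), mul_right_comm]
    rfl

end Characteristic

/-! ### The limit theorem -/

theorem mainTheorem3 {Ω : Type*} [MeasurableSpace Ω] (P : Measure Ω) [IsProbabilityMeasure P]
    -- the noise field `Y_{ij}`, `i, j ≥ 1`: iid, centred, variance `σ² > 0`, moment `4 + ε`
    (Y : ℕ → ℕ → Ω → ℝ)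
    (hmeas : ∀ i j, 1 ≤ i → 1 ≤ j → Measurable (Y i j))
    (hindep : iIndepFun (fun p : ℕ × ℕ => Y (p.1 + 1) (p.2 + 1)) P)
    (hident : ∀ i j, 1 ≤ i → 1 ≤ j → IdentDistrib (Y i j) (Y 1 1) P P)
    (hmean : ∀ i j, 1 ≤ i → 1 ≤ j → ∫ ω, Y i j ω ∂P = 0)
    (σ : ℝ) (hσ : 0 < σ)
    (hvar : ∀ i j, 1 ≤ i → 1 ≤ j → Var[Y i j; P] = σ ^ 2)
    (ε : ℝ) (hε : 0 < ε)
    (hmom : ∀ i j, 1 ≤ i → 1 ≤ j → Integrable (fun ω => |Y i j ω| ^ (4 + ε)) P)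
    -- block lengths `l₁ n = n ^ s₁` and `l₂ m = m ^ s₂`, up to rounding to an integer
    (s₁ s₂ : ℝ) (hs₁ : s₁ ∈ Set.Ioo (1 / 2 : ℝ) 1) (hs₂ : s₂ ∈ Set.Ioo (1 / 2 : ℝ) 1)
    (l₁ l₂ : ℕ → ℕ)
    (hl₁ : ∀ n, 1 ≤ n → |(l₁ n : ℝ) - (n : ℝ) ^ s₁| < 1)
    (hl₂ : ∀ m, 1 ≤ m → |(l₂ m : ℝ) - (m : ℝ) ^ s₂| < 1) :
    -- convergence in distribution to `N(0, 1)` as `N = n m → ∞`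
    TendstoInDistribution
      (fun (q : ℕ × ℕ) (ω : Ω) =>
        blockStatistic Y P σ (l₁ q.1) (l₂ q.2)
          (numBlocks (l₁ q.1) q.1) (numBlocks (l₂ q.2) q.2) ω)
      (comap (fun q : ℕ × ℕ => q.1 * q.2) atTop)
      (id : ℝ → ℝ) (fun _ => P) (gaussianReal 0 1) := by

  have hσ' : σ ≠ 0 := hσ.ne'
  let X : ℕ × ℕ → Ω → ℝ := fun p ω => σ⁻¹ * Y (p.1 + 1) (p.2 + 1) ω
  have hXY : ∀ p, X p = fun ω => σ⁻¹ * Y (p.1 + 1) (p.2 + 1) ω := fun p => rfl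
  have hYm : ∀ p : ℕ × ℕ, Measurable (Y (p.1 + 1) (p.2 + 1)) := fun p =>
    hmeas _ _ (by omega) (by omega)
  have hm : ∀ p, Measurable (X p) := fun p => (hYm p).const_mul _
  have hXindep : iIndepFun X P := hindep.comp (fun _ x => σ⁻¹ * x) fun _ => by fun_prop
  have hXid : ∀ p p', IdentDistrib (X p) (X p') P P := fun p p' =>
    ((hident _ _ (by omega) (by omega)).trans
      (hident _ _ (by omega) (by omega)).symm).comp (u := fun x => σ⁻¹ * x) (by fun_prop)
  have hX4 : ∀ p, MemLp (X p) 4 P := by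
    intro p
    have hp : (0 : ℝ) < 4 + ε := by linarith
    have h : MemLp (Y (p.1 + 1) (p.2 + 1)) (ENNReal.ofReal (4 + ε)) P := by
      rw [← integrable_norm_rpow_iff (hYm p).aestronglyMeasurable (by simpa using hp) (by simp),
        ENNReal.toReal_ofReal hp.le]
      exact hmom _ _ (by omega) (by omega)
    refine (h.mono_exponent ?_).const_mul _
    rw [← ENNReal.ofReal_ofNat]
    exact ENNReal.ofReal_le_ofReal (by linarith)
  have h0 : ∀ p, ∫ ω, X p ω ∂P = 0 := fun p => by
    simp only [X]
    rw [integral_const_mul, hmean _ _ (by omega) (by omega), mul_zero]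
  have h2 : ∀ p, ∫ ω, X p ω ^ 2 ∂P = 1 := fun p => by
    have h := hvar (p.1 + 1) (p.2 + 1) (by omega) (by omega)
    rw [variance_eq_integral (hYm p).aemeasurable, hmean _ _ (by omega) (by omega)] at h
    simp only [sub_zero] at h
    simp only [X, mul_pow]
    rw [integral_const_mul, h]
    field_simp
  have h4 : ∀ p, ∫ ω, X p ω ^ 4 ∂P = ∫ ω, X (0, 0) ω ^ 4 ∂P := fun p =>
    ((hXid p (0, 0)).comp (u := fun x => x ^ 4) (by fun_prop)).integral_eq
  have hs₁' : 0 < s₁ := by linarith [hs₁.1]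
  have hs₂' : 0 < s₂ := by linarith [hs₂.1]
  have hM : Tendsto (fun q : ℕ × ℕ => l₁ q.1 * l₂ q.2)
      (comap (fun q : ℕ × ℕ => q.1 * q.2) atTop) atTop :=
    tendsto_mul_comap_mul_atTop two_pos hs₁' hs₂'
      (fun n hn => rpow_le_two_mul_blockLength hs₁'.le hn (hl₁ n hn))
      (fun n hn => rpow_le_two_mul_blockLength hs₂'.le hn (hl₂ n hn))
  have hB : Tendsto (fun q : ℕ × ℕ => numBlocks (l₁ q.1) q.1 * numBlocks (l₂ q.2) q.2)
      (comap (fun q : ℕ × ℕ => q.1 * q.2) atTop) atTop :=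
    tendsto_mul_comap_mul_atTop four_pos (sub_pos.2 hs₁.2) (sub_pos.2 hs₂.2)
      (fun n hn => rpow_le_four_mul_numBlocks hs₁'.le hs₁.2.le hn (hl₁ n hn))
      (fun n hn => rpow_le_four_mul_numBlocks hs₂'.le hs₂.2.le hn (hl₂ n hn))
  refine ⟨fun q => (measurable_blockStatistic hmeas σ _ _ _ _).aemeasurable, aemeasurable_id, ?_⟩
  -- The filter nm → ∞ is countably generated, so sequences suffice; Lévy's continuity theorem is
  -- applied along each.
  refine tendsto_of_seq_tendsto fun u hu => ?_
  refine ProbabilityMeasure.tendsto_iff_tendsto_charFun.2 fun t => ?_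
  have key := tendsto_charFun_sq_normalizedSum_pow (X := fun k => X (0, k))
    (hXindep.precomp (g := fun k : ℕ => (0, k)) fun _ _ h => (Prod.ext_iff.1 h).2)
    (fun k => hm _) (fun k => hXid _ _) (fun k => hX4 _) (fun k => h0 _) (fun k => h2 _)
    (fun k => h4 _) (hM.comp hu) (hB.comp hu) t
  have hlim : charFun ((gaussianReal 0 1).map id) t = Complex.exp (-(t ^ 2 / 2 : ℝ)) := by
    rw [Measure.map_id, charFun_gaussianReal]
    congr 1
    simp
  change Tendsto (fun n => charFun (P.map (blockStatistic Y P σ (l₁ (u n).1) (l₂ (u n).2)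
    (numBlocks (l₁ (u n).1) (u n).1) (numBlocks (l₂ (u n).2) (u n).2))) t) atTop
    (nhds (charFun ((gaussianReal 0 1).map id) t))
  rw [hlim]
  refine key.congr' ?_
  filter_upwards [(hM.comp hu).eventually_ne_atTop 0, (hB.comp hu).eventually_ne_atTop 0]
    with n hln hbn
  have hstat := charFun_map_blockStatistic hσ' hXY hXindep hm (fun p => (hXid p _).map_eq) hln hbn t
  rw [kappa4_eq hσ' hXY hXindep hm (fun p => (hXid p _).map_eq) hX4 h0 h2 h4 hln] at hstat
  refine Eq.trans ?_ hstat.symm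
  simp only [Function.comp_apply]
  -- What differs is the variance: 2 + (m - 3)/M against κ - 1 with κ = 3 + (m - 3)/M.
  congr 5
  ring_nf
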